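/- All rings are commutative with unity, and local rings are Noetherian. Let $B$ be a local ring containing an infinite field $K$, and let $T=\widehat{B}$ be the completion of $B$ at its maximal ideal. Suppose that $T/I$ is a regular local ring for every minimal prime ideal $I$ of $T$. Let $P_1,\dots,P_m$ be the distinct minimal prime ideals of $B$. Let $n$ be a positive integer, let $y$ and $z$ be indeterminates, let $A=B[[y,z]]$, and put $P_j'=(P_j,y,z)A$ for $j=1,\dots,m$. Then there are distinct elements $\beta_1,\dots,\beta_n$ of $K$ such that the ideals $Q_i=(P_1,\,y+\beta_i z)A$, $i=1,\dots,n$, are distinct prime ideals of $A$ with the following properties. 1. For every $i=1,\dots,n$ and $j=1,\dots,m$, we have $Q_i\subseteq P_j'$ if and only if $j=1$. 2. For every $i=1,\dots,n$, the ideal $P_1'/Q_i$ of the ring $A/Q_i$ is a prime ideal of height one. 3. If $J=\left(\bigcap_{i=1}^{n}Q_i\right)\cap P_2'\cap\cdots\cap P_m'$, then $S=A/J$ is a local ring and, for every minimal prime ideal $Q$ of its completion $\widehat{S}$ at its maximal ideal, $\widehat{S}/Q$ is a regular local ring. -/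

import Mathlib

/-- The completion of the local ring `R` at its maximal ideal, modulo each of its minimal prime
ideals, is a regular local ring. -/
def CompletionModMinimalPrimesRegular (R : Type*) [CommRing R] [IsLocalRing R]
    [IsNoetherianRing R] : Prop :=
  ∀ I ∈ minimalPrimes (AdicCompletion (IsLocalRing.maximalIdeal R) R),
    IsRegularLocalRing (AdicCompletion (IsLocalRing.maximalIdeal R) R ⧸ I)

/-- The power series ring `B[[y, z]]`; the variables are `y = X 0` and `z = X 1`. -/
abbrev PowerSeriesYZ (B : Type*) [CommRing B] : Type _ := MvPowerSeries (Fin 2) B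

/-- The ideal `(P, y, z)` of `B[[y, z]]`. -/
noncomputable def idealPYZ {B : Type*} [CommRing B] (P : Ideal B) : Ideal (PowerSeriesYZ B) :=
  P.map (MvPowerSeries.C : B →+* PowerSeriesYZ B) ⊔
    Ideal.span {MvPowerSeries.X 0, MvPowerSeries.X 1}

/-- The ideal `(P, y + b z)` of `B[[y, z]]`. -/
noncomputable def idealPLine {B : Type*} [CommRing B] (P : Ideal B) (b : B) :
    Ideal (PowerSeriesYZ B) :=
  P.map (MvPowerSeries.C : B →+* PowerSeriesYZ B) ⊔
    Ideal.span {MvPowerSeries.X 0 + MvPowerSeries.C b * MvPowerSeries.X 1}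

/-! The completion of `A = B[[y,z]]` is `T[[y,z]]`, and since this ring is Noetherian the completion
of `A/J` is `T[[y,z]]/J T[[y,z]]`. So the minimal primes of the completion of `S` correspond to the
primes `p` minimal over `J T[[y,z]]`. Such a `p` contracts to a prime containing `J`, a finite
intersection, hence contains the extension of some `Q_i` or some `P_j'`. By minimality `p` is `(q, y
+ βz)` or `(q, y, z)` with `q` minimal over `P_j T`. Going down along the flat map `B → T` makes `q`
a minimal prime of `T`, so `T/q` is regular. The residue ring at `p` is `(T/q)[[z]]` or `T/q`,
regular in both cases. The other claims come from `A/Q_i ≅ (B/P_1)[[z]]`, a domain in which `P_1'`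
becomes the ideal `(z)`. The field `K` supplies slopes whose differences are units, which separates
the `Q_i`. -/

/-- A ring homomorphism `f : R → S` exhibits `S` as the `I`-adic completion of `R`: the ring `S` is
complete for the extension of `I`, and `R / I ^ n → S / I ^ n S` is bijective for every `n`. -/
structure IsAdicCompletionMap {R S : Type*} [CommRing R] [CommRing S] (f : R →+* S)
    (I : Ideal R) : Prop where
  complete : IsAdicComplete (I.map f) S
  mem_pow : ∀ n x, f x ∈ I.map f ^ n → x ∈ I ^ n
  dense : ∀ n s, ∃ r, s - f r ∈ I.map f ^ n

/-! ### Completions and their behaviour under quotients -/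

namespace IsAdicCompletionMap

theorem adicCompletion {R : Type*} [CommRing R] {I : Ideal R} (hI : I.FG) :
    IsAdicCompletionMap (algebraMap R (AdicCompletion I R)) I := by
  have key : ∀ n (x : AdicCompletion I R),
      x ∈ I.map (algebraMap R (AdicCompletion I R)) ^ n ↔ AdicCompletion.eval I R n x = 0 := by
    intro n x
    rw [← LinearMap.mem_ker, ← AdicCompletion.pow_smul_top_eq_ker_eval hI, ← Ideal.map_pow,
      Ideal.smul_top_eq_map]
    rfl
  refine ⟨AdicCompletion.isAdicComplete_self I hI, fun n x hx ↦ ?_, fun n s ↦ ?_⟩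
  · rw [key, AdicCompletion.algebraMap_apply] at hx
    have hx : Ideal.Quotient.mk (I ^ n • ⊤ : Ideal R) x = 0 := hx
    simpa [Ideal.Quotient.eq_zero_iff_mem] using hx
  · obtain ⟨r, hr⟩ := Ideal.Quotient.mk_surjective (AdicCompletion.eval I R n s)
    refine ⟨r, ?_⟩
    rw [key, map_sub, sub_eq_zero, ← hr, AdicCompletion.algebraMap_apply]
    rfl

variable {R S R' : Type*} [CommRing R] [CommRing S] [CommRing R'] {f : R →+* S} {I : Ideal R}

theorem exists_toQuotient (h : IsAdicCompletionMap f I) (π : R →+* R') (n : ℕ) :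
    ∃ g : S →+* R' ⧸ I.map π ^ n,
      (∀ r, g (f r) = Ideal.Quotient.mk _ (π r)) ∧ ∀ s ∈ I.map f ^ n, g s = 0 := by
  let e₀ : R ⧸ I ^ n →+* S ⧸ I.map f ^ n := Ideal.quotientMap _ f (by
    rw [← Ideal.map_le_iff_le_comap, Ideal.map_pow])
  have he₀ : Function.Bijective e₀ := by
    constructor
    · exact Ideal.quotientMap_injective' (fun x hx ↦ h.mem_pow n x hx)
    · intro s
      obtain ⟨s, rfl⟩ := Ideal.Quotient.mk_surjective s
      obtain ⟨r, hr⟩ := h.dense n s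
      exact ⟨Ideal.Quotient.mk _ r, by
        simpa [e₀] using ((Ideal.Quotient.mk_eq_mk_iff_sub_mem _ _).2 hr).symm⟩
  let e := RingEquiv.ofBijective e₀ he₀
  let g₀ : R ⧸ I ^ n →+* R' ⧸ I.map π ^ n := Ideal.quotientMap _ π (by
    rw [← Ideal.map_le_iff_le_comap, Ideal.map_pow])
  refine ⟨g₀.comp (e.symm.toRingHom.comp (Ideal.Quotient.mk _)), fun r ↦ ?_, fun s hs ↦ ?_⟩
  · have : e.symm (Ideal.Quotient.mk _ (f r)) = Ideal.Quotient.mk _ r := by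
      rw [RingEquiv.symm_apply_eq]
      simp [e, e₀]
    simp [this, g₀]
  · simp [Ideal.Quotient.eq_zero_iff_mem.2 hs]

/-- The maps to the truncations `R' / (I R')^n` glue. Surjectivity lifts from the reduction modulo
`I`, as `S` is complete and the target separated. Without Noetherian hypotheses the kernel is only
pinned down up to `I`-adic closure. -/
theorem exists_toAdicCompletion (h : IsAdicCompletionMap f I) {π : R →+* R'}
    (hπ : Function.Surjective π) (hI : (I.map π).FG) :
    ∃ φ : S →+* AdicCompletion (I.map π) R', Function.Surjective φ ∧
      (RingHom.ker π).map f ≤ RingHom.ker φ ∧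
      ∀ n, RingHom.ker φ ≤ (RingHom.ker π).map f ⊔ I.map f ^ n := by
  choose g hg hg0 using h.exists_toQuotient π
  have hc : ∀ {m n : ℕ} (hle : m ≤ n),
      (Ideal.Quotient.factorPow (I.map π) hle).comp (g n) = g m := by
    intro m n hle
    ext s
    obtain ⟨r, hr⟩ := h.dense n s
    obtain ⟨t, ht, rfl⟩ : ∃ t ∈ I.map f ^ n, s = f r + t := ⟨_, hr, by ring⟩
    simp [hg, hg0 n t ht, hg0 m t (Ideal.pow_le_pow_right hle ht)]
  let φ := AdicCompletion.liftRingHom (I.map π) g hc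
  have hφ : φ.comp f = (algebraMap R' (AdicCompletion (I.map π) R')).comp π := by
    refine RingHom.ext fun r ↦ AdicCompletion.ext_evalₐ fun n ↦ ?_
    simp [φ, hg]
  have hIφ : (I.map f).map φ = (I.map π).map (algebraMap R' (AdicCompletion (I.map π) R')) := by
    rw [Ideal.map_map, hφ, ← Ideal.map_map]
  refine ⟨φ, ?_, ?_, ?_⟩
  · have := h.complete.toIsPrecomplete
    have hcomp := AdicCompletion.isAdicComplete_self (I.map π) hI
    rw [← hIφ] at hcomp
    have := hcomp.toIsHausdorff
    apply surjective_of_mk_map_comp_surjective (I := I.map f)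
    intro y
    obtain ⟨y, rfl⟩ := Ideal.Quotient.mk_surjective y
    obtain ⟨r', hr'⟩ := (adicCompletion hI).dense 1 y
    obtain ⟨r, rfl⟩ := hπ r'
    refine ⟨f r, ?_⟩
    rw [RingHom.comp_apply, eq_comm, Ideal.Quotient.mk_eq_mk_iff_sub_mem, hIφ]
    have : φ (f r) = algebraMap R' (AdicCompletion (I.map π) R') (π r) := congr($hφ r)
    rw [this]
    simpa using hr'
  · rw [Ideal.map_le_iff_le_comap]
    intro r hr
    have : φ (f r) = algebraMap R' (AdicCompletion (I.map π) R') (π r) := congr($hφ r)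
    rw [Ideal.mem_comap, RingHom.mem_ker, this, (RingHom.mem_ker).1 hr, map_zero]
  · intro n s hs
    obtain ⟨r, hr⟩ := h.dense n s
    obtain ⟨t, ht, rfl⟩ : ∃ t ∈ I.map f ^ n, s = f r + t := ⟨_, hr, by ring⟩
    refine add_mem ?_ (Ideal.mem_sup_right ht)
    have h0 : g n (f r + t) = 0 := by
      rw [← AdicCompletion.evalₐ_liftRingHom (I.map π) g hc]
      exact congr(AdicCompletion.evalₐ (I.map π) n $hs).trans (map_zero _)
    rw [map_add, hg, hg0 n t ht, add_zero, Ideal.Quotient.eq_zero_iff_mem, ← Ideal.map_pow,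
      Ideal.mem_map_iff_of_surjective π hπ] at h0
    obtain ⟨x, hx, hxr⟩ := h0
    have : f r = f (r - x) + f x := by simp
    rw [this]
    refine Ideal.add_mem _ (Ideal.mem_sup_left (Ideal.mem_map_of_mem f ?_)) (Ideal.mem_sup_right ?_)
    · simp [RingHom.mem_ker, hxr]
    · rw [← Ideal.map_pow]
      exact Ideal.mem_map_of_mem f hx

/-- Completeness puts `I S` in the Jacobson radical, so by Krull's intersection theorem the ideal
generated by `ker π` is already closed. -/
theorem exists_toAdicCompletion_of_isNoetherianRing [IsNoetherianRing S]
    (h : IsAdicCompletionMap f I) {π : R →+* R'}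
    (hπ : Function.Surjective π) (hI : (I.map π).FG) :
    ∃ φ : S →+* AdicCompletion (I.map π) R', Function.Surjective φ ∧
      RingHom.ker φ = (RingHom.ker π).map f := by
  obtain ⟨φ, hφ, hle, hn⟩ := h.exists_toAdicCompletion hπ hI
  refine ⟨φ, hφ, le_antisymm (fun s hs ↦ ?_) hle⟩
  have := h.complete
  have : IsHausdorff (I.map f) (S ⧸ (RingHom.ker π).map f) :=
    IsHausdorff.of_le_jacobson _ _ (IsAdicComplete.le_jacobson_bot _)
  rw [← Ideal.Quotient.eq_zero_iff_mem]
  refine this.haus _ fun n ↦ ?_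
  rw [SModEq.zero]
  obtain ⟨a, ha, b, hb, rfl⟩ := Submodule.mem_sup.1 (hn n hs)
  rw [map_add, Ideal.Quotient.eq_zero_iff_mem.2 ha, zero_add]
  have : Ideal.Quotient.mk ((RingHom.ker π).map f) b = b • 1 := by
    rw [Algebra.smul_def, mul_one]; rfl
  rw [this]
  exact Submodule.smul_mem_smul hb trivial

end IsAdicCompletionMap

/-- Sending variables to generators of `I` makes the completion a quotient of a power series ring in
finitely many variables over `R`. -/
theorem AdicCompletion.isNoetherianRing {R : Type*} [CommRing R] [IsNoetherianRing R]
    (I : Ideal R) : IsNoetherianRing (AdicCompletion I R) := by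
  obtain ⟨n, a, ha⟩ := Submodule.fg_iff_exists_fin_generating_family.1
    (IsNoetherian.noetherian I)
  let π : MvPolynomial (Fin n) R →ₐ[R] R := MvPolynomial.aeval a
  have hπ : Function.Surjective π := fun r ↦ ⟨MvPolynomial.C r, by simp [π]⟩
  have hI : (MvPolynomial.idealOfVars (Fin n) R).map π.toRingHom = I := by
    rw [← ha, MvPolynomial.idealOfVars, Ideal.map_span, ← Set.range_comp]
    congr 2
    ext i
    simp [π]
  have := isNoetherianRing_of_ringEquiv (MvPowerSeries (Fin n) R)
    (MvPowerSeries.toAdicCompletionAlgEquiv (Fin n) R).toRingEquiv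
  obtain ⟨φ, hφ, -⟩ := (IsAdicCompletionMap.adicCompletion
    (MvPolynomial.idealOfVars_fg (Fin n) R)).exists_toAdicCompletion (π := π.toRingHom) hπ
    (IsNoetherian.noetherian _)
  have := isNoetherianRing_of_surjective _ _ φ hφ
  rwa [hI] at this

/-! ### The adic topology of `R[[y,z]]` -/

theorem MvPowerSeries.exists_coeff_eq {σ R : Type*} [CommRing R] (c : (σ →₀ ℕ) → R) :
    ∃ f : MvPowerSeries σ R, ∀ d, coeff d f = c d :=
  ⟨c, fun _ ↦ rfl⟩

open MvPowerSeries in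
theorem MvPowerSeries.exists_eq_add_X_mul {R : Type*} [CommRing R] (f : MvPowerSeries (Fin 2) R) :
    ∃ f₀ f₁ : MvPowerSeries (Fin 2) R, f = C (coeff 0 f) + X 0 * f₀ + X 1 * f₁ ∧
      (∀ d, coeff d f₀ = coeff (d + Finsupp.single 0 1) f) ∧
      ∀ d, coeff d f₁ = coeff (d + Finsupp.single 1 1) f ∨ coeff d f₁ = 0 := by
  classical
  obtain ⟨f₀, h₀⟩ := exists_coeff_eq fun d ↦ coeff (d + Finsupp.single 0 1) f
  -- Monomials divisible by `y` all go to `f₀`; only pure powers of `z` remain for `f₁`, so nothing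
  -- is counted twice.
  obtain ⟨f₁, h₁⟩ := exists_coeff_eq fun d ↦
    if d 0 = 0 then coeff (d + Finsupp.single 1 1) f else 0
  refine ⟨f₀, f₁, ?_, h₀, fun d ↦ ?_⟩
  · ext d
    have h (i : Fin 2) (g : MvPowerSeries (Fin 2) R) :
        coeff d (X i * g) = if d i = 0 then 0 else coeff (d - Finsupp.single i 1) g := by
      rw [X, coeff_monomial_mul, one_mul]
      simp only [Finsupp.single_le_iff, Nat.one_le_iff_ne_zero, ite_not]
    have h' (i : Fin 2) (hi : d i ≠ 0) : d - Finsupp.single i 1 + Finsupp.single i 1 = d :=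
      tsub_add_cancel_of_le (by simpa [Finsupp.single_le_iff, Nat.one_le_iff_ne_zero] using hi)
    rw [map_add, map_add, h, h, coeff_C, h₀, h₁]
    by_cases h0 : d 0 = 0
    · by_cases h1 : d 1 = 0
      · have : d = 0 := by ext i; fin_cases i <;> simpa
        simp [this]
      · have : d ≠ 0 := by rintro rfl; simp at h1
        rw [if_neg this, if_pos h0, if_neg h1, if_pos (by simp [h0]), h' 1 h1]
        simp
    · have : d ≠ 0 := by rintro rfl; simp at h0
      have h01 : (d - Finsupp.single 1 1 : Fin 2 →₀ ℕ) 0 ≠ 0 := by simpa using h0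
      rw [if_neg this, if_neg h0, h' 0 h0, if_neg h01, ite_self]
      simp
  · rw [h₁]
    split_ifs <;> simp

section

open MvPowerSeries

section idealPYZ

variable {R S : Type*} [CommRing R] [CommRing S]

theorem mem_idealPYZ_iff (I : Ideal R) (f : PowerSeriesYZ R) :
    f ∈ idealPYZ I ↔ constantCoeff f ∈ I := by
  constructor
  · suffices idealPYZ I ≤ I.comap (constantCoeff (σ := Fin 2) (R := R)) from fun h ↦ this h
    refine sup_le (Ideal.map_le_iff_le_comap.2 fun x hx ↦ ?_) (Ideal.span_le.2 ?_)
    · simpa using hx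
    · rintro x (rfl | rfl) <;> simp
  · intro h
    obtain ⟨f₀, f₁, hf, -⟩ := exists_eq_add_X_mul f
    rw [hf, add_assoc]
    refine add_mem (Ideal.mem_sup_left (Ideal.mem_map_of_mem _ h)) (Ideal.mem_sup_right ?_)
    exact add_mem (Ideal.mul_mem_right _ _ (Ideal.subset_span (by simp)))
      (Ideal.mul_mem_right _ _ (Ideal.subset_span (by simp)))

theorem idealPYZ_eq_comap (I : Ideal R) :
    idealPYZ I = I.comap (constantCoeff (σ := Fin 2) (R := R)) :=
  Ideal.ext (mem_idealPYZ_iff I)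

/-- Each variable counts as one factor of the ideal, so a coefficient of degree `k` needs only `n -
k` factors from `I` (none once `k ≥ n`). This reduces completeness and density to coefficients. -/
theorem mem_idealPYZ_pow_iff (I : Ideal R) (n : ℕ) (f : PowerSeriesYZ R) :
    f ∈ idealPYZ I ^ n ↔ ∀ d, coeff d f ∈ I ^ (n - d.degree) := by
  classical
  constructor
  · induction n generalizing f with
    | zero => simp
    | succ n ih =>
      intro h
      rw [pow_succ] at h
      refine Submodule.mul_induction_on h (fun a ha b hb d ↦ ?_) fun a b ha hb d ↦ ?_
      · rw [coeff_mul]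
        refine Ideal.sum_mem _ fun ⟨u, v⟩ huv ↦ ?_
        replace huv : u + v = d := by simpa using huv
        have hb' : coeff v b ∈ I ^ (1 - v.degree) := by
          by_cases hv : v = 0
          · subst hv
            simpa using (mem_idealPYZ_iff I b).1 hb
          · have : 1 - v.degree = 0 := by
              have := (Finsupp.degree_eq_zero_iff v).not.2 hv
              lia
            simp [this]
        refine Ideal.pow_le_pow_right ?_ (pow_add I _ _ ▸ Ideal.mul_mem_mul (ih a ha u) hb')
        have : d.degree = u.degree + v.degree := by
          rw [← huv, map_add]
        lia
      · rw [map_add]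
        exact add_mem (ha d) (hb d)
  · induction n generalizing f with
    | zero => simp
    | succ n ih =>
      intro h
      obtain ⟨f₀, f₁, hf, h₀, h₁⟩ := exists_eq_add_X_mul f
      have hd (i : Fin 2) (d : Fin 2 →₀ ℕ) :
          coeff (d + Finsupp.single i 1) f ∈ I ^ (n - d.degree) := by
        have := h (d + Finsupp.single i 1)
        rwa [map_add, Finsupp.degree_single, Nat.add_sub_add_right] at this
      rw [hf]
      refine add_mem (add_mem ?_ ?_) ?_
      · refine Ideal.pow_right_mono le_sup_left _ ?_
        rw [← Ideal.map_pow]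
        exact Ideal.mem_map_of_mem _ (by simpa using h 0)
      · rw [pow_succ']
        refine Ideal.mul_mem_mul (Ideal.mem_sup_right (Ideal.subset_span (by simp)))
          (ih _ fun d ↦ ?_)
        rw [h₀]
        exact hd 0 d
      · rw [pow_succ']
        refine Ideal.mul_mem_mul (Ideal.mem_sup_right (Ideal.subset_span (by simp)))
          (ih _ fun d ↦ ?_)
        obtain h | h := h₁ d
        · rw [h]; exact hd 1 d
        · rw [h]; exact zero_mem _

theorem map_idealPYZ (f : R →+* S) (I : Ideal R) :
    (idealPYZ I).map (MvPowerSeries.map (σ := Fin 2) f) = idealPYZ (I.map f) := by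
  have : (MvPowerSeries.map (σ := Fin 2) f).comp C = C.comp f := by
    ext1; simp
  rw [idealPYZ, Ideal.map_sup, Ideal.map_map, this, ← Ideal.map_map, Ideal.map_span]
  simp [idealPYZ, Set.image_insert_eq]

theorem map_idealPLine (f : R →+* S) (I : Ideal R) (b : R) :
    (idealPLine I b).map (MvPowerSeries.map (σ := Fin 2) f) = idealPLine (I.map f) (f b) := by
  have : (MvPowerSeries.map (σ := Fin 2) f).comp C = C.comp f := by
    ext1; simp
  rw [idealPLine, Ideal.map_sup, Ideal.map_map, this, ← Ideal.map_map, Ideal.map_span]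
  simp [idealPLine]

theorem idealPYZ_isAdicComplete (I : Ideal R) [IsAdicComplete I R] :
    IsAdicComplete (idealPYZ I) (PowerSeriesYZ R) where
  haus' f hf := by
    ext d
    refine IsHausdorff.haus (I := I) inferInstance _ fun n ↦ ?_
    have := hf (n + d.degree)
    rw [SModEq.zero, smul_eq_mul, Ideal.mul_top, mem_idealPYZ_pow_iff] at this
    rw [SModEq.zero, smul_eq_mul, Ideal.mul_top]
    simpa using this d
  prec' f hf := by
    -- The shift by `d.degree` offsets the loss in the exponent, making the sequence of `d`-th
    -- coefficients `I`-adically Cauchy.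
    have key (d : Fin 2 →₀ ℕ) : ∃ L : R, ∀ n, coeff d (f (n + d.degree)) - L ∈ I ^ n := by
      obtain ⟨L, hL⟩ := IsPrecomplete.prec (I := I) (M := R) inferInstance
        (f := fun n ↦ coeff d (f (n + d.degree))) (fun {m n} hmn ↦ by
          have := hf (Nat.add_le_add_right hmn d.degree)
          rw [SModEq.sub_mem, smul_eq_mul, Ideal.mul_top, mem_idealPYZ_pow_iff] at this
          rw [SModEq.sub_mem, smul_eq_mul, Ideal.mul_top]
          simpa using this d)
      refine ⟨L, fun n ↦ ?_⟩
      have := hL n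
      rwa [SModEq.sub_mem, smul_eq_mul, Ideal.mul_top] at this
    choose L hL using key
    obtain ⟨g, hg⟩ := exists_coeff_eq L
    refine ⟨g, fun n ↦ ?_⟩
    rw [SModEq.sub_mem, smul_eq_mul, Ideal.mul_top, mem_idealPYZ_pow_iff]
    intro d
    by_cases hd : n ≤ d.degree
    · simp [Nat.sub_eq_zero_of_le hd]
    · have := hL d (n - d.degree)
      rw [Nat.sub_add_cancel (by lia)] at this
      rwa [map_sub, hg]

theorem IsAdicCompletionMap.powerSeriesYZ {f : R →+* S} {I : Ideal R}
    (h : IsAdicCompletionMap f I) :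
    IsAdicCompletionMap (MvPowerSeries.map (σ := Fin 2) f) (idealPYZ I) where
  complete := by
    have := h.complete
    rw [map_idealPYZ]
    exact idealPYZ_isAdicComplete _
  mem_pow n x hx := by
    rw [map_idealPYZ, mem_idealPYZ_pow_iff] at hx
    rw [mem_idealPYZ_pow_iff]
    exact fun d ↦ h.mem_pow _ _ (by simpa using hx d)
  dense n s := by
    choose r hr using fun d : Fin 2 →₀ ℕ ↦ h.dense (n - d.degree) (coeff d s)
    obtain ⟨g, hg⟩ := exists_coeff_eq r
    refine ⟨g, ?_⟩
    rw [map_idealPYZ, mem_idealPYZ_pow_iff]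
    intro d
    rw [map_sub, coeff_map, hg]
    exact hr d

end idealPYZ

/-! ### Regularity and primality of the quotients -/

theorem PowerSeries.isRegularLocalRing (R : Type*) [CommRing R] [IsRegularLocalRing R] :
    IsRegularLocalRing (PowerSeries R) := by
  have hm : (IsLocalRing.maximalIdeal (PowerSeries R)).map PowerSeries.constantCoeff =
      IsLocalRing.maximalIdeal R := by
    refine le_antisymm (Ideal.map_le_iff_le_comap.2 fun f hf ↦ ?_) fun x hx ↦ ?_
    · rw [Ideal.mem_comap, IsLocalRing.mem_maximalIdeal, mem_nonunits_iff]
      rwa [IsLocalRing.mem_maximalIdeal, mem_nonunits_iff, PowerSeries.isUnit_iff_constantCoeff]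
        at hf
    · rw [← PowerSeries.constantCoeff_C x]
      refine Ideal.mem_map_of_mem _ ?_
      rw [IsLocalRing.mem_maximalIdeal, mem_nonunits_iff] at hx ⊢
      rwa [PowerSeries.isUnit_iff_constantCoeff, PowerSeries.constantCoeff_C]
  have hX : (PowerSeries.X : PowerSeries R) ∈ IsLocalRing.maximalIdeal (PowerSeries R) := by
    rw [IsLocalRing.mem_maximalIdeal, mem_nonunits_iff, PowerSeries.isUnit_iff_constantCoeff]
    simp
  -- Adjoining the variable costs at most one generator of the maximal ideal and raises the
  -- dimension by at least one.
  apply IsRegularLocalRing.of_spanFinrank_maximalIdeal_le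
  have h := PowerSeries.spanFinrank_le_spanFinrank_map_constantCoeff_add_one_of_X_mem hX
  rw [hm] at h
  calc ((IsLocalRing.maximalIdeal (PowerSeries R)).spanFinrank : WithBot ℕ∞)
      ≤ (IsLocalRing.maximalIdeal R).spanFinrank + 1 := by exact_mod_cast h
    _ = ringKrullDim R + 1 := by rw [IsRegularLocalRing.spanFinrank_maximalIdeal]
    _ ≤ _ := ringKrullDim_succ_le_ringKrullDim_powerseries

section

variable {R : Type*} [CommRing R]

/-- One finite generating family serves all coefficients at once, so the multipliers assemble into
finitely many series. -/
theorem MvPowerSeries.mem_map_C_of_coeff_mem {σ : Type*} {I : Ideal R} (hI : I.FG)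
    {f : MvPowerSeries σ R} (hf : ∀ d, coeff d f ∈ I) :
    f ∈ I.map (C : R →+* MvPowerSeries σ R) := by
  obtain ⟨n, a, rfl⟩ := Submodule.fg_iff_exists_fin_generating_family.1 hI
  choose c hc using fun d ↦ (Submodule.mem_span_range_iff_exists_fun R).1 (hf d)
  choose g hg using fun i ↦ exists_coeff_eq (σ := σ) fun d ↦ c d i
  have : f = ∑ i, g i * C (a i) := by
    ext d
    simp [hg, ← hc, coeff_mul_C]
  rw [this]
  exact Ideal.sum_mem _ fun i _ ↦ Ideal.mul_mem_left _ _
    (Ideal.mem_map_of_mem _ (Submodule.subset_span (by simp)))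

/-- Substituting with `-b` inverts the substitution. This automorphism carries `(I, y)` to `(I, y +
bz)`. -/
theorem PowerSeriesYZ.exists_shear (b : R) :
    ∃ τ : PowerSeriesYZ R ≃+* PowerSeriesYZ R, (∀ r, τ (C r) = C r) ∧ τ (X 1) = X 1 ∧
      τ (X 0) = X 0 + C b * X 1 := by
  let v (b : R) : Fin 2 → PowerSeriesYZ R := ![X 0 + C b * X 1, X 1]
  have hv (b : R) : HasSubst (v b) := hasSubst_of_constantCoeff_zero fun i ↦ by
    fin_cases i <;> simp [v]
  have hC (b r : R) : substAlgHom (R := R) (hv b) (C r) = C r := (substAlgHom (hv b)).commutes r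
  have hcomp (b c : R) (h : b + c = 0) (f : PowerSeriesYZ R) :
      substAlgHom (hv c) (substAlgHom (hv b) f) = f := by
    have hid : (fun s ↦ substAlgHom (hv c) (v b s)) = X := by
      funext i
      fin_cases i
      · have : C b * X 1 + C c * X 1 = (0 : PowerSeriesYZ R) := by
          rw [← add_mul, ← map_add, h, map_zero, zero_mul]
        have h0 : substAlgHom (R := R) (hv c) (X 0) = X 0 + C c * X 1 := substAlgHom_X (hv c) 0
        have h1 : substAlgHom (R := R) (hv c) (X 1) = X 1 := substAlgHom_X (hv c) 1
        change substAlgHom (R := R) (hv c) (X 0 + C b * X 1) = X 0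
        rw [map_add, map_mul, hC, h0, h1, add_assoc, add_comm (C c * X 1), this, add_zero]
      · exact substAlgHom_X (hv c) 1
    rw [substAlgHom_comp_substAlgHom_apply, substAlgHom_apply, hid, subst_self, id]
  refine ⟨RingEquiv.ofRingHom (substAlgHom (R := R) (hv b)).toRingHom
    (substAlgHom (R := R) (hv (-b))).toRingHom (RingHom.ext fun f ↦ hcomp (-b) b (by simp) f)
    (RingHom.ext fun f ↦ hcomp b (-b) (by simp) f), fun r ↦ hC b r, ?_, ?_⟩
  · exact substAlgHom_X (hv b) 1
  · exact substAlgHom_X (hv b) 0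

theorem PowerSeriesYZ.exists_toPowerSeries {I : Ideal R} (hI : I.FG) :
    ∃ ε : PowerSeriesYZ R →+* PowerSeries (R ⧸ I), Function.Surjective ε ∧
      RingHom.ker ε = I.map C ⊔ Ideal.span {X 0} ∧ ε (X 1) = PowerSeries.X := by
  let e := (finSuccEquiv R 1).toRingEquiv
  let ρ : MvPowerSeries (Fin 1) (R ⧸ I) ≃+* PowerSeries (R ⧸ I) :=
    (renameEquiv (R ⧸ I) (Equiv.ofUnique (Fin 1) Unit)).toRingEquiv
  let μ : MvPowerSeries (Fin 1) R →+* MvPowerSeries (Fin 1) (R ⧸ I) :=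
    MvPowerSeries.map (Ideal.Quotient.mk I)
  have hμ : Function.Surjective μ := by
    intro g
    choose r hr using fun d ↦ Ideal.Quotient.mk_surjective (coeff d g)
    obtain ⟨f, hf⟩ := exists_coeff_eq r
    refine ⟨f, ?_⟩
    ext d
    simp [μ, hf, hr]
  refine ⟨ρ.toRingHom.comp (μ.comp (PowerSeries.constantCoeff.comp e.toRingHom)), ?_, ?_, ?_⟩
  · exact ρ.surjective.comp (hμ.comp (PowerSeries.constantCoeff_surj.comp e.surjective))
  · apply le_antisymm
    · intro f hf
      have hf : μ (PowerSeries.constantCoeff (e f)) = 0 := by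
        simpa [RingHom.mem_ker] using hf
      have hc : PowerSeries.constantCoeff (e f) ∈ I.map (C : R →+* MvPowerSeries (Fin 1) R) :=
        mem_map_C_of_coeff_mem hI fun d ↦ by
          rw [← Ideal.Quotient.eq_zero_iff_mem]
          simpa [μ] using congr(coeff d $hf)
      have key (g : PowerSeries (MvPowerSeries (Fin 1) R)) :
          g = PowerSeries.C (PowerSeries.constantCoeff g) +
            PowerSeries.X * PowerSeries.mk fun p ↦ PowerSeries.coeff (p + 1) g :=
        g.eq_X_mul_shift_add_const.trans (add_comm _ _)
      have hf' : f = e.symm (PowerSeries.C (PowerSeries.constantCoeff (e f))) + X 0 *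
          e.symm (PowerSeries.mk fun p ↦ PowerSeries.coeff (p + 1) (e f)) := by
        apply e.injective
        have : e (X 0) = PowerSeries.X := finSuccEquiv_X_zero
        rw [map_add, map_mul, e.apply_symm_apply, e.apply_symm_apply, this]
        exact key (e f)
      rw [hf']
      refine add_mem (Ideal.mem_sup_left ?_)
        (Ideal.mul_mem_right _ _ (Ideal.mem_sup_right (Ideal.subset_span rfl)))
      have hC : (e.symm.toRingHom.comp (PowerSeries.C.comp MvPowerSeries.C)) =
        (MvPowerSeries.C : R →+* PowerSeriesYZ R) := finSuccEquiv_comp_C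
      rw [← hC, ← RingHom.comp_assoc, ← Ideal.map_map]
      exact Ideal.mem_map_of_mem _ hc
    · refine sup_le (Ideal.map_le_iff_le_comap.2 fun x hx ↦ ?_) (Ideal.span_le.2 ?_)
      · simp [e, μ, Ideal.Quotient.eq_zero_iff_mem.2 hx]
      · rintro _ rfl
        simp [e]
  · have : finSuccEquiv R 1 (X 1) = PowerSeries.C (X 0) := finSuccEquiv_X_succ 0
    simp [e, this, μ, ρ]
    rfl

theorem idealPLine_exists_toPowerSeries {I : Ideal R} (hI : I.FG) (b : R) :
    ∃ ε : PowerSeriesYZ R →+* PowerSeries (R ⧸ I), Function.Surjective ε ∧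
      RingHom.ker ε = idealPLine I b ∧ ε (X 1) = PowerSeries.X := by
  obtain ⟨ε, hε, hker, hX⟩ := PowerSeriesYZ.exists_toPowerSeries hI
  obtain ⟨τ, hC, h1, h0⟩ := PowerSeriesYZ.exists_shear b
  refine ⟨ε.comp τ.symm.toRingHom, hε.comp τ.symm.surjective, ?_, ?_⟩
  · have hτ : τ.toRingHom.comp C = C := RingHom.ext hC
    rw [← RingHom.comap_ker, hker]
    change Ideal.comap τ.symm _ = _
    rw [← Ideal.map_comap_of_equiv]
    change Ideal.map τ.toRingHom _ = _
    rw [Ideal.map_sup, Ideal.map_map, hτ, Ideal.map_span, idealPLine]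
    simp [h0]
  · have : τ.symm (X 1) = X 1 := by rw [RingEquiv.symm_apply_eq, h1]
    simp [this, hX]

theorem idealPLine_isPrime {I : Ideal R} [I.IsPrime] (hI : I.FG) (b : R) :
    (idealPLine I b).IsPrime := by
  obtain ⟨ε, -, hker, -⟩ := idealPLine_exists_toPowerSeries hI b
  rw [← hker]
  exact RingHom.ker_isPrime ε

theorem X_one_notMem_idealPLine {I : Ideal R} [I.IsPrime] (hI : I.FG) (b : R) :
    X 1 ∉ idealPLine I b := by
  obtain ⟨ε, -, hker, hX⟩ := idealPLine_exists_toPowerSeries hI b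
  rw [← hker, RingHom.mem_ker, hX]
  exact PowerSeries.X_ne_zero

theorem isRegularLocalRing_quotient_idealPLine {I : Ideal R} [IsRegularLocalRing (R ⧸ I)]
    (hI : I.FG) (b : R) : IsRegularLocalRing (PowerSeriesYZ R ⧸ idealPLine I b) := by
  obtain ⟨ε, hε, hker, -⟩ := idealPLine_exists_toPowerSeries hI b
  rw [← hker]
  have := PowerSeries.isRegularLocalRing (R ⧸ I)
  exact .of_ringEquiv (RingHom.quotientKerEquivOfSurjective hε).symm

theorem isRegularLocalRing_quotient_idealPYZ {I : Ideal R} [IsRegularLocalRing (R ⧸ I)] :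
    IsRegularLocalRing (PowerSeriesYZ R ⧸ idealPYZ I) := by
  let ε := (Ideal.Quotient.mk I).comp (constantCoeff (σ := Fin 2) (R := R))
  have hε : Function.Surjective ε :=
    Ideal.Quotient.mk_surjective.comp fun r ↦ ⟨C r, constantCoeff_C r⟩
  have hker : RingHom.ker ε = idealPYZ I := by
    rw [idealPYZ_eq_comap, ← RingHom.comap_ker, Ideal.mk_ker]
  rw [← hker]
  exact .of_ringEquiv (RingHom.quotientKerEquivOfSurjective hε).symm

theorem idealPYZ_isPrime (I : Ideal R) [I.IsPrime] : (idealPYZ I).IsPrime := by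
  rw [idealPYZ_eq_comap]
  infer_instance

end

/-! ### Minimal primes of the completion -/

/-- Going down yields a prime inside `q` lying over `p`; it contains `pS`, so it equals `q`. A prime
below `q` then contracts into `p`, hence onto `p` by minimality, so it also contains `pS` and equals
`q`. -/
theorem Ideal.mem_minimalPrimes_of_mem_minimalPrimes_map {R S : Type*} [CommRing R] [CommRing S]
    [Algebra R S] [Algebra.HasGoingDown R S] {p : Ideal R} (hp : p ∈ minimalPrimes R)
    {q : Ideal S} (hq : q ∈ (p.map (algebraMap R S)).minimalPrimes) : q ∈ minimalPrimes S := by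
  have := hp.1.1
  have := hq.1.1
  obtain ⟨q', hle, hq', hlies⟩ := Ideal.exists_ideal_le_liesOver_of_le (q := q.under R) q
    (Ideal.map_le_iff_le_comap.1 hq.1.2)
  have hqq' : q = q' := le_antisymm
    (hq.2 ⟨hq', Ideal.map_le_iff_le_comap.2 hlies.over.le⟩ hle) hle
  rw [← hqq'] at hlies
  refine ⟨⟨hq.1.1, bot_le⟩, fun r hr hrq ↦ hq.2 ⟨hr.1, Ideal.map_le_iff_le_comap.2 ?_⟩ hrq⟩
  have := hr.1
  refine hp.2 ⟨Ideal.IsPrime.comap _, bot_le⟩ ?_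
  rw [hlies.over]
  exact Ideal.comap_mono hrq

theorem IsAdicCompletionMap.isRegularLocalRing_quotient_minimalPrimes {R S R' : Type*} [CommRing R]
    [CommRing S] [CommRing R'] [IsNoetherianRing S] [IsNoetherianRing R'] {f : R →+* S}
    {I : Ideal R} (h : IsAdicCompletionMap f I) {π : R →+* R'} (hπ : Function.Surjective π)
    (hreg : ∀ p ∈ ((RingHom.ker π).map f).minimalPrimes, IsRegularLocalRing (S ⧸ p))
    {I' : Ideal R'} (hI' : I.map π = I') :
    ∀ q ∈ minimalPrimes (AdicCompletion I' R'), IsRegularLocalRing (AdicCompletion I' R' ⧸ q) := by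
  subst hI'
  obtain ⟨φ, hφ, hker⟩ :=
    h.exists_toAdicCompletion_of_isNoetherianRing hπ (IsNoetherian.noetherian _)
  intro q hq
  have hφq : Function.Surjective ((Ideal.Quotient.mk q).comp φ) :=
    Ideal.Quotient.mk_surjective.comp hφ
  have hkerq : RingHom.ker ((Ideal.Quotient.mk q).comp φ) = q.comap φ := by
    rw [← RingHom.comap_ker, Ideal.mk_ker]
  have := hreg (RingHom.ker ((Ideal.Quotient.mk q).comp φ)) (by
    rw [← hker, hkerq]
    exact Ideal.minimalPrimes_comap_of_surjective hφ hq)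
  exact .of_ringEquiv (RingHom.quotientKerEquivOfSurjective hφq)

theorem idealPYZ_maximalIdeal (R : Type*) [CommRing R] [IsLocalRing R] :
    idealPYZ (IsLocalRing.maximalIdeal R) = IsLocalRing.maximalIdeal (PowerSeriesYZ R) := by
  ext f
  rw [mem_idealPYZ_iff, IsLocalRing.mem_maximalIdeal, IsLocalRing.mem_maximalIdeal,
    mem_nonunits_iff, mem_nonunits_iff, isUnit_iff_constantCoeff]

/-! ### Comparison of the ideals `(P, y + bz)` and `(P, y, z)` -/

section

variable {R : Type*} [CommRing R]

theorem X_zero_add_mem_idealPLine (I : Ideal R) (b : R) : X 0 + C b * X 1 ∈ idealPLine I b :=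
  Ideal.mem_sup_right (Ideal.subset_span rfl)

theorem idealPLine_le_idealPYZ_iff {I J : Ideal R} {b : R} :
    idealPLine I b ≤ idealPYZ J ↔ I ≤ J := by
  refine ⟨fun h x hx ↦ ?_, fun h ↦ sup_le ((Ideal.map_mono h).trans le_sup_left) ?_⟩
  · simpa [mem_idealPYZ_iff] using h (Ideal.mem_sup_left (Ideal.mem_map_of_mem _ hx))
  · rw [Ideal.span_singleton_le_iff_mem, mem_idealPYZ_iff]
    simp

theorem idealPLine_mono {I J : Ideal R} (h : I ≤ J) (b : R) : idealPLine I b ≤ idealPLine J b :=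
  sup_le_sup_right (Ideal.map_mono h) _

theorem idealPYZ_mono {I J : Ideal R} (h : I ≤ J) : idealPYZ I ≤ idealPYZ J :=
  sup_le_sup_right (Ideal.map_mono h) _

theorem eq_of_idealPLine_eq {K : Type*} [Field K] [Algebra K R] {I : Ideal R} [I.IsPrime]
    (hI : I.FG) {a b : K}
    (h : idealPLine I (algebraMap K R a) = idealPLine I (algebraMap K R b)) : a = b := by
  by_contra hab
  refine X_one_notMem_idealPLine hI (algebraMap K R b) ?_
  -- The two linear forms differ by `(a - b) z`, and `a - b` is a unit, so a common ideal would
  -- contain `z`.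
  have h1 := h ▸ X_zero_add_mem_idealPLine I (algebraMap K R a)
  have h2 := sub_mem h1 (X_zero_add_mem_idealPLine I (algebraMap K R b))
  have h3 := Ideal.mul_mem_left _ (C (algebraMap K R (a - b)⁻¹)) h2
  have h4 : C (algebraMap K R (a - b)⁻¹) * (X 0 + C (algebraMap K R a) * X 1 -
      (X 0 + C (algebraMap K R b) * X 1)) = (X 1 : PowerSeriesYZ R) := by
    rw [add_sub_add_left_eq_sub, ← sub_mul, ← map_sub, ← map_sub, ← mul_assoc, ← map_mul,
      ← map_mul, inv_mul_cancel₀ (sub_ne_zero.2 hab), map_one, map_one, one_mul]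
  rwa [h4] at h3

theorem map_mk_idealPLine_idealPYZ (I : Ideal R) (b : R) :
    (idealPYZ I).map (Ideal.Quotient.mk (idealPLine I b)) =
      Ideal.span {Ideal.Quotient.mk (idealPLine I b) (X 1)} := by
  refine le_antisymm (Ideal.map_le_iff_le_comap.2 (sup_le ?_ (Ideal.span_le.2 ?_))) ?_
  · intro x hx
    have hx' : x ∈ idealPLine I b := Ideal.mem_sup_left hx
    rw [Ideal.mem_comap, Ideal.Quotient.eq_zero_iff_mem.2 hx']
    exact zero_mem _
  · have h1 : Ideal.Quotient.mk (idealPLine I b) (X 1) ∈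
        Ideal.span {Ideal.Quotient.mk (idealPLine I b) (X 1)} := Ideal.subset_span rfl
    rintro x (rfl | rfl)
    · have h0 := Ideal.Quotient.eq_zero_iff_mem.2 (X_zero_add_mem_idealPLine I b)
      rw [map_add, map_mul, add_eq_zero_iff_eq_neg] at h0
      rw [SetLike.mem_coe, Ideal.mem_comap, h0]
      exact neg_mem (Ideal.mul_mem_left _ _ h1)
    · exact h1
  · rw [Ideal.span_singleton_le_iff_mem]
    exact Ideal.mem_map_of_mem _ (Ideal.mem_sup_right (Ideal.subset_span (by simp)))

theorem isPrime_map_mk_idealPLine_idealPYZ (I : Ideal R) [I.IsPrime] (b : R) :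
    ((idealPYZ I).map (Ideal.Quotient.mk (idealPLine I b))).IsPrime := by
  have := idealPYZ_isPrime I
  refine Ideal.map_isPrime_of_surjective Ideal.Quotient.mk_surjective ?_
  rw [Ideal.mk_ker]
  exact idealPLine_le_idealPYZ_iff.2 le_rfl

/-- Modulo the line, `y` is a multiple of `z`, so the ideal is generated by `z`, a nonzero nonunit
of a domain. -/
theorem height_map_mk_idealPLine_idealPYZ [IsNoetherianRing R] (I : Ideal R) [I.IsPrime] (b : R) :
    ((idealPYZ I).map (Ideal.Quotient.mk (idealPLine I b))).height = 1 := by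
  have := idealPLine_isPrime (IsNoetherian.noetherian I) b
  have hp := (isPrime_map_mk_idealPLine_idealPYZ I b).ne_top
  rw [map_mk_idealPLine_idealPYZ] at hp ⊢
  refine Ideal.height_span_singleton_eq_one_of_mem_nonZeroDivisors ?_ ?_
  · rw [mem_nonZeroDivisors_iff_ne_zero, Ne, Ideal.Quotient.eq_zero_iff_mem]
    exact X_one_notMem_idealPLine (IsNoetherian.noetherian I) b
  · rwa [Ne, Ideal.span_singleton_eq_top] at hp

/-- For `q` minimal over `I` inside the contraction of `p`, the prime `(q, y + bz)` lies between `J`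
and `p`, and `p` is minimal over `J`. -/
theorem exists_minimalPrimes_idealPLine_eq [IsNoetherianRing R] {I : Ideal R} {b : R}
    {J p : Ideal (PowerSeriesYZ R)} (hJ : J ≤ idealPLine I b) (hp : p ∈ J.minimalPrimes)
    (h : idealPLine I b ≤ p) : ∃ q ∈ I.minimalPrimes, p = idealPLine q b := by
  have := hp.1.1
  obtain ⟨q, hq, hqp⟩ := Ideal.exists_minimalPrimes_le (I := I) (J := p.comap C)
    (Ideal.map_le_iff_le_comap.1 (le_sup_left.trans h))
  have := hq.1.1
  have hle : idealPLine q b ≤ p := sup_le (Ideal.map_le_iff_le_comap.2 hqp) (le_sup_right.trans h)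
  exact ⟨q, hq, le_antisymm (hp.2 ⟨idealPLine_isPrime (IsNoetherian.noetherian q) b,
    hJ.trans (idealPLine_mono hq.1.2 b)⟩ hle) hle⟩

theorem exists_minimalPrimes_idealPYZ_eq {I : Ideal R} {J p : Ideal (PowerSeriesYZ R)}
    (hJ : J ≤ idealPYZ I) (hp : p ∈ J.minimalPrimes)
    (h : idealPYZ I ≤ p) : ∃ q ∈ I.minimalPrimes, p = idealPYZ q := by
  have := hp.1.1
  obtain ⟨q, hq, hqp⟩ := Ideal.exists_minimalPrimes_le (I := I) (J := p.comap C)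
    (Ideal.map_le_iff_le_comap.1 (le_sup_left.trans h))
  have := hq.1.1
  have hle : idealPYZ q ≤ p := sup_le (Ideal.map_le_iff_le_comap.2 hqp) (le_sup_right.trans h)
  exact ⟨q, hq, le_antisymm (hp.2 ⟨idealPYZ_isPrime q, hJ.trans (idealPYZ_mono hq.1.2)⟩ hle) hle⟩

end

/-! ### Assembly of the theorem -/

theorem CompletionModMinimalPrimesRegular.quotient_powerSeriesYZ {B : Type*} [CommRing B]
    [IsLocalRing B] [IsNoetherianRing B] (hB : CompletionModMinimalPrimesRegular B)
    {ι κ : Type*} [Finite ι] [Finite κ] (P : ι → Ideal B) (b : ι → B) (P' : κ → Ideal B)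
    (hP : ∀ i, P i ∈ minimalPrimes B) (hP' : ∀ j, P' j ∈ minimalPrimes B)
    (J : Ideal (PowerSeriesYZ B)) (hJ : J = (⨅ i, idealPLine (P i) (b i)) ⊓ ⨅ j, idealPYZ (P' j))
    [IsLocalRing (PowerSeriesYZ B ⧸ J)] :
    CompletionModMinimalPrimesRegular (PowerSeriesYZ B ⧸ J) := by
  cases nonempty_fintype ι
  cases nonempty_fintype κ
  have : IsNoetherianRing (AdicCompletion (IsLocalRing.maximalIdeal B) B) :=
    AdicCompletion.isNoetherianRing _
  have hm : (idealPYZ (IsLocalRing.maximalIdeal B)).map (Ideal.Quotient.mk J) =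
      IsLocalRing.maximalIdeal (PowerSeriesYZ B ⧸ J) := by
    rw [idealPYZ_maximalIdeal]
    exact IsLocalRing.map_maximalIdeal_of_surjective _ Ideal.Quotient.mk_surjective
  refine (IsAdicCompletionMap.adicCompletion
    (IsNoetherian.noetherian (IsLocalRing.maximalIdeal B))).powerSeriesYZ
    |>.isRegularLocalRing_quotient_minimalPrimes Ideal.Quotient.mk_surjective ?_ hm
  rw [Ideal.mk_ker]
  intro p hp
  have := hp.1.1
  have hpJ := Ideal.map_le_iff_le_comap.1 hp.1.2
  -- A prime containing a finite intersection contains one of its members.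
  rw [hJ, (Ideal.IsPrime.comap _).inf_le, ← Finset.inf_univ_eq_iInf, ← Finset.inf_univ_eq_iInf,
    (Ideal.IsPrime.comap _).inf_le', (Ideal.IsPrime.comap _).inf_le'] at hpJ
  obtain ⟨i, -, hi⟩ | ⟨j, -, hj⟩ := hpJ
  · have hJi : J ≤ idealPLine (P i) (b i) := by
      rw [hJ]
      exact inf_le_left.trans (iInf_le _ i)
    rw [← Ideal.map_le_iff_le_comap, map_idealPLine] at hi
    obtain ⟨q, hq, rfl⟩ := exists_minimalPrimes_idealPLine_eq
      ((Ideal.map_mono hJi).trans (map_idealPLine _ _ _).le) hp hi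
    have := hB q (Ideal.mem_minimalPrimes_of_mem_minimalPrimes_map (hP i) hq)
    exact isRegularLocalRing_quotient_idealPLine (IsNoetherian.noetherian q) _
  · have hJj : J ≤ idealPYZ (P' j) := by
      rw [hJ]
      exact inf_le_right.trans (iInf_le _ j)
    rw [← Ideal.map_le_iff_le_comap, map_idealPYZ] at hj
    obtain ⟨q, hq, rfl⟩ := exists_minimalPrimes_idealPYZ_eq
      ((Ideal.map_mono hJj).trans (map_idealPYZ _ _).le) hp hj
    have := hB q (Ideal.mem_minimalPrimes_of_mem_minimalPrimes_map (hP' j) hq)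
    exact isRegularLocalRing_quotient_idealPYZ

end

theorem mainTheorem4 {B K : Type*} [CommRing B] [IsLocalRing B] [IsNoetherianRing B]
    [Field K] [Infinite K] [Algebra K B]
    (hB : CompletionModMinimalPrimesRegular B)
    (m : ℕ) [NeZero m] (P : Fin m → Ideal B) (hP : Function.Injective P)
    (hPmin : Set.range P = minimalPrimes B)
    (n : ℕ) (hn : 0 < n) :
    ∃ (β : Fin n → K) (Q : Fin n → Ideal (PowerSeriesYZ B)),
      Function.Injective β ∧
      (∀ i, Q i = idealPLine (P 0) (algebraMap K B (β i))) ∧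
      (∀ i, (Q i).IsPrime) ∧
      Function.Injective Q ∧
      (∀ i j, Q i ≤ idealPYZ (P j) ↔ j = 0) ∧
      (∀ i, ((idealPYZ (P 0)).map (Ideal.Quotient.mk (Q i))).IsPrime ∧
        ((idealPYZ (P 0)).map (Ideal.Quotient.mk (Q i))).height = 1) ∧
      ∀ J : Ideal (PowerSeriesYZ B),
        J = (⨅ i, Q i) ⊓ (⨅ j, ⨅ (_ : j ≠ 0), idealPYZ (P j)) →
        ∃ (_ : IsLocalRing (PowerSeriesYZ B ⧸ J)) (_ : IsNoetherianRing (PowerSeriesYZ B ⧸ J)),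
          CompletionModMinimalPrimesRegular (PowerSeriesYZ B ⧸ J) := by
  have hmin (j : Fin m) : P j ∈ minimalPrimes B := hPmin ▸ Set.mem_range_self j
  have hprime (j : Fin m) : (P j).IsPrime := (hmin j).1.1
  have hfg (I : Ideal B) : I.FG := IsNoetherian.noetherian I
  let β : Fin n → K := fun i ↦ Infinite.natEmbedding K i
  have hβ : Function.Injective β := fun i j h ↦
    Fin.ext ((Infinite.natEmbedding K).injective h)
  refine ⟨β, fun i ↦ idealPLine (P 0) (algebraMap K B (β i)), hβ, fun _ ↦ rfl,
    fun i ↦ idealPLine_isPrime (hfg _) _, fun i j h ↦ hβ (eq_of_idealPLine_eq (hfg _) h),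
    fun i j ↦ ?_, fun i ↦ ⟨isPrime_map_mk_idealPLine_idealPYZ _ _,
      height_map_mk_idealPLine_idealPYZ _ _⟩, fun J hJ ↦ ?_⟩
  · rw [idealPLine_le_idealPYZ_iff]
    refine ⟨fun h ↦ hP (le_antisymm ((hmin j).2 (hmin 0).1 h) h), ?_⟩
    rintro rfl
    exact le_rfl
  · have hJ' : J = (⨅ i, idealPLine (P 0) (algebraMap K B (β i))) ⊓
        ⨅ j : {j : Fin m // j ≠ 0}, idealPYZ (P j) := by
      rw [hJ, iInf_subtype']
    -- Since `n > 0`, at least one proper ideal `Q_i` enters the intersection, even when `m = 1`.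
    have hJtop : J ≠ ⊤ := fun h ↦
      (idealPLine_isPrime (hfg (P 0)) (algebraMap K B (β ⟨0, hn⟩))).ne_top
        (top_le_iff.1 (h ▸ hJ ▸ inf_le_left.trans (iInf_le _ _)))
    have := Ideal.Quotient.nontrivial_iff.2 hJtop
    have hloc : IsLocalRing (PowerSeriesYZ B ⧸ J) :=
      IsLocalRing.of_surjective' (Ideal.Quotient.mk J) Ideal.Quotient.mk_surjective
    exact ⟨hloc, inferInstance, hB.quotient_powerSeriesYZ (fun _ ↦ P 0) _ _ (fun _ ↦ hmin 0)
      (fun j : {j : Fin m // j ≠ 0} ↦ hmin j) J hJ'⟩
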